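/- Let $a,b,c\ge 0$ be integers and let $\mathbf{x}_a=(x_1,\dots,x_a)$ and $\mathbf{z}_b=(z_1,\dots,z_b)$ be variables (or elements of any commutative ring). Then $$\sum_{\lambda\in \mathrm{P}(\min(a,b),c)} s_\lambda(\mathbf{x}_a)\,s_\lambda(\mathbf{z}_b)=\sum_{\mu\in \mathrm{P}(b,c)} g_\mu(\mathbf{x}_a;\mathbf{z}_b).$$ Here $\mathrm{P}(m,n)$ is the set of partitions whose Young diagram has at most $m$ rows and at most $n$ columns. The Schur polynomial is $s_\lambda(\mathbf{x}_n)=\sum_T\prod_{(i,j)} x_{T_{i,j}}$, where $T$ runs over the fillings of the Young diagram of $\lambda$ with entries in $\{1,\dots,n\}$ whose rows are weakly decreasing and whose columns are strictly decreasing, and $(i,j)$ runs over the cells of the diagram. A plane partition is a matrix $\pi=(\pi_{i,j})_{i,j\ge1}$ of nonnegative integers with finitely many nonzero entries and $\pi_{i,j}\ge\pi_{i+1,j}$, $\pi_{i,j}\ge\pi_{i,j+1}$ for all $i,j$; its diagram is $D(\pi)=\{(i,j,k):1\le k\le\pi_{i,j}\}$, and its set of corners is $\mathrm{Cor}(\pi)=\{(i,j,k)\in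 D(\pi):(i+1,j,k)\notin D(\pi),\ (i,j+1,k)\notin D(\pi)\}$. The refined dual stable Grothendieck polynomial is $$g_\mu(\mathbf{x}_a;\mathbf{z}_b)=\sum_{\pi}\ \prod_{(i,j,k)\in\mathrm{Cor}(\pi)} x_i z_j,$$ where $\pi$ runs over the plane partitions with $\pi_{i,j}=0$ unless $i\le a$ and $j\le b$, whose first row $(\pi_{1,1},\pi_{1,2},\dots)$ is $\mu$. -/

import Mathlib

/-! All indices start at `0` here: the row, column, height or variable with index `i` in the usual
notation (starting from `1`) has index `i - 1` below.  Partitions are Mathlib's `YoungDiagram`s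
(English convention, `(i, j)` is the cell in row `i` and column `j`). -/

/-- The partitions whose Young diagram lies inside the box `[a] × [b]`: at most `a` rows, and at
most `b` columns. -/
def partitionsInBoxSet (a b : ℕ) : Set YoungDiagram :=
  {μ | ∀ p ∈ μ.cells, p.1 < a ∧ p.2 < b}

theorem partitionsInBoxSet_finite (a b : ℕ) : (partitionsInBoxSet a b).Finite := by
  refine Set.Finite.of_finite_image (f := YoungDiagram.cells) ?_ ?_
  · refine (Finset.finite_toSet (Finset.range a ×ˢ Finset.range b).powerset).subset ?_
    rintro _ ⟨μ, hμ, rfl⟩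
    simp only [Finset.coe_powerset, Set.mem_preimage, Set.mem_powerset_iff, Finset.coe_subset]
    intro p hp
    have := hμ p hp
    simpa using this
  · intro μ _ ν _ h
    exact YoungDiagram.ext h

/-- The finite set `P(a, b)` of partitions whose Young diagram lies inside `[a] × [b]`. -/
noncomputable def partitionsInBox (a b : ℕ) : Finset YoungDiagram :=
  (partitionsInBoxSet_finite a b).toFinset

/-- A filling `T` of the diagram of `μ` with `n` letters is a column-strict plane partition if its
rows are weakly decreasing and its columns are strictly decreasing. -/
def IsColumnStrict (μ : YoungDiagram) {n : ℕ} (T : μ.cells → Fin n) : Prop :=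
  (∀ p q : μ.cells, p.1.1 = q.1.1 → p.1.2 ≤ q.1.2 → T q ≤ T p) ∧
  (∀ p q : μ.cells, p.1.2 = q.1.2 → p.1.1 < q.1.1 → T q < T p)

open Classical in
/-- The Schur polynomial `s_μ(x_0, …, x_{n-1})`, as a sum over column-strict plane partitions of
shape `μ`.  Only the first `n` terms of the sequence `x` occur in it. -/
noncomputable def schurPoly {R : Type*} [CommRing R] (μ : YoungDiagram) (n : ℕ) (x : ℕ → R) : R :=
  ∑ T : μ.cells → Fin n with IsColumnStrict μ T, ∏ p : μ.cells, x (T p)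

/-- A plane partition: a matrix of nonnegative integers with finitely many nonzero entries that is
weakly decreasing in both directions. -/
@[ext]
structure PlanePartition where
  entry : ℕ → ℕ → ℕ
  succ_row_le : ∀ i j, entry (i + 1) j ≤ entry i j
  succ_col_le : ∀ i j, entry i (j + 1) ≤ entry i j
  finite_support : {p : ℕ × ℕ | entry p.1 p.2 ≠ 0}.Finite

namespace PlanePartition

/-- The diagram of a plane partition, as a set of boxes `(i, j, k)`. -/
def diagram (π : PlanePartition) : Set (ℕ × ℕ × ℕ) :=
  {p | p.2.2 < π.entry p.1 p.2.1}

/-- The corners of `π`: the boxes `(i, j, k)` of the diagram such that neither `(i + 1, j, k)` nor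
`(i, j + 1, k)` is in the diagram. -/
def cornerSet (π : PlanePartition) : Set (ℕ × ℕ × ℕ) :=
  {p | p ∈ π.diagram ∧ (p.1 + 1, p.2.1, p.2.2) ∉ π.diagram ∧
    (p.1, p.2.1 + 1, p.2.2) ∉ π.diagram}

theorem entry_le (π : PlanePartition) (i j : ℕ) : π.entry i j ≤ π.entry 0 0 :=
  (antitone_nat_of_succ_le (f := fun i => π.entry i j) (fun i => π.succ_row_le i j)
    (Nat.zero_le i)).trans
    (antitone_nat_of_succ_le (f := fun j => π.entry 0 j) (fun j => π.succ_col_le 0 j)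
      (Nat.zero_le j))

theorem cornerSet_finite (π : PlanePartition) : π.cornerSet.Finite := by
  refine ((π.finite_support.prod (Set.finite_Iio (π.entry 0 0))).image
    (fun q : (ℕ × ℕ) × ℕ => (q.1.1, q.1.2, q.2))).subset ?_
  rintro ⟨i, j, k⟩ ⟨h, -⟩
  have h' : k < π.entry i j := h
  exact ⟨((i, j), k), ⟨(Nat.zero_lt_of_lt h').ne', h'.trans_le (π.entry_le i j)⟩, rfl⟩

/-- The finite set `Cor(π)` of corners of `π`. -/
noncomputable def corners (π : PlanePartition) : Finset (ℕ × ℕ × ℕ) :=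
  π.cornerSet_finite.toFinset

/-- The plane partitions with at most `a` nonzero rows and at most `b` nonzero columns whose side
shape, that is the partition given by the first row, is `μ`.  The entries of such a plane partition
are automatically at most the first part of `μ`, so it lies in the box `[a] × [b] × [c]` for every
`c` that bounds this part. -/
def withSideShapeSet (a b : ℕ) (μ : YoungDiagram) : Set PlanePartition :=
  {π | (∀ i j, π.entry i j ≠ 0 → i < a ∧ j < b) ∧ ∀ j, π.entry 0 j = μ.rowLen j}

theorem withSideShapeSet_finite (a b : ℕ) (μ : YoungDiagram) :
    (withSideShapeSet a b μ).Finite := by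
  refine Set.Finite.of_finite_image
    (f := fun π (p : Fin a × Fin b) => π.entry p.1 p.2) ?_ ?_
  · refine (Set.Finite.pi' (fun _ : Fin a × Fin b => Set.finite_Iic (μ.rowLen 0))).subset ?_
    rintro _ ⟨π, hπ, rfl⟩ p
    exact (π.entry_le _ _).trans_eq (hπ.2 0)
  · intro π hπ ρ hρ h
    ext i j
    by_cases hij : i < a ∧ j < b
    · exact congrFun h (⟨i, hij.1⟩, ⟨j, hij.2⟩)
    · rw [not_not.1 (mt (hπ.1 i j) hij), not_not.1 (mt (hρ.1 i j) hij)]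

/-- The finite set of plane partitions with at most `a` nonzero rows, at most `b` nonzero columns
and side shape `μ`. -/
noncomputable def withSideShape (a b : ℕ) (μ : YoungDiagram) : Finset PlanePartition :=
  (withSideShapeSet_finite a b μ).toFinset

end PlanePartition

/-- The refined dual stable Grothendieck polynomial `g_μ(x_0, …, x_{a-1}; z_0, …, z_{b-1})`.  Only
the first `a` terms of the sequence `x` and the first `b` terms of the sequence `z` occur in it. -/
noncomputable def dualGrothendieckPoly {R : Type*} [CommRing R] (μ : YoungDiagram) (a b : ℕ)
    (x z : ℕ → R) : R :=
  ∑ π ∈ PlanePartition.withSideShape a b μ, ∏ p ∈ π.corners, x p.1 * z p.2.1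

/-!
Both sides are expanded over the possible first rows `G` of a plane partition and shown to agree
for every single `G`.

On the right, position `(i, j)` carries `w_{i,j} = π_{i,j} - max(π_{i+1,j}, π_{i,j+1})` corners
(`PlanePartition.prod_corners`).  A plane partition is therefore the table of last passage times of
the matrix `w`, weighted by `∏ (x_i z_j)^{w_{i,j}}`, and its rows form a chain with transition
weight `rowWeight` (`dualGrothendieckPoly_succ`).

On the left, `s_ν(z_b)` is a sum over chains `∅ ≺ ⋯ ≺ ν` of interlacing partitions
(`schurPoly_succ`); recording the first parts of the members of such a chain as the parts of a
diagram `G` refines it to the polynomials `chainPoly b z ν G` (`sum_chainPoly_eq_schurPoly`).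
The RSK correspondence in its growth diagram form then does the rest.  For fixed `α` and `μ` the
local rule `γ_i + ν_{i+1} = min(α_i, μ_i) + max(α_{i+1}, μ_{i+1})` is a bijection between the `ν`
above `α` and `μ` with a prescribed first part `t`, and the `γ` below them; it changes the weights
by the factor `(x z)^{t - max(α_0, μ_0)}` (`YoungDiagram.sum_localRule`).  Since
`t - max(α_0, μ_0)` is a last passage increment, pushing one variable `x` of `s_ν(x_a)` through a
whole chain makes its first parts perform one step of last passage percolation
(`sum_interlaces_chainPoly`).  Induction on the number of variables `x` gives
`∑_ν s_ν(x_a) chainPoly b z ν G = g_G(x_a; z_b)` (`sum_schurPoly_mul_chainPoly`).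
-/

/-! ### Young diagrams, row lengths and interlacing -/

namespace YoungDiagram

theorem ext_rowLen {μ ν : YoungDiagram} (h : ∀ i, μ.rowLen i = ν.rowLen i) : μ = ν := by
  ext ⟨i, j⟩
  rw [mem_cells, mem_cells, mem_iff_lt_rowLen, mem_iff_lt_rowLen, h]

theorem le_iff_rowLen_le {μ ν : YoungDiagram} : μ ≤ ν ↔ ∀ i, μ.rowLen i ≤ ν.rowLen i := by
  constructor
  · intro h i
    by_contra! hlt
    have : (i, ν.rowLen i) ∈ ν := h (mem_iff_lt_rowLen.2 hlt)
    exact lt_irrefl _ (mem_iff_lt_rowLen.1 this)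
  · rintro h ⟨i, j⟩ hij
    exact mem_iff_lt_rowLen.2 ((mem_iff_lt_rowLen.1 hij).trans_le (h i))

@[simp]
theorem rowLen_bot (i : ℕ) : (⊥ : YoungDiagram).rowLen i = 0 := by
  by_contra h
  exact notMem_bot _ (mem_iff_lt_rowLen.2 (Nat.pos_of_ne_zero h))

theorem eq_bot_iff_rowLen_zero {μ : YoungDiagram} : μ = ⊥ ↔ μ.rowLen 0 = 0 := by
  refine ⟨fun h => by simp [h], fun h => ext_rowLen fun i => ?_⟩
  have := μ.rowLen_anti 0 i (Nat.zero_le i)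
  simp; omega

theorem rowLen_colLen_zero (μ : YoungDiagram) : μ.rowLen (μ.colLen 0) = 0 := by
  by_contra h
  exact lt_irrefl _ (mem_iff_lt_colLen.1 (mem_iff_lt_rowLen.2 (Nat.pos_of_ne_zero h)))

theorem card_eq_sum_rowLen (μ : YoungDiagram) {n : ℕ} (hn : μ.rowLen n = 0) :
    μ.card = ∑ i ∈ Finset.range n, μ.rowLen i := by
  rw [YoungDiagram.card, Finset.card_eq_sum_card_fiberwise (f := Prod.fst) (t := Finset.range n)]
  · exact Finset.sum_congr rfl fun i _ => (μ.rowLen_eq_card (i := i)).symm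
  · rintro ⟨i, j⟩ hij
    have h := mem_iff_lt_rowLen.1 ((mem_cells _).1 hij)
    simp only [Finset.coe_range, Set.mem_Iio]
    by_contra! hi
    have := μ.rowLen_anti n i hi
    omega

open Classical in
/-- The Young diagram whose row lengths are given by `f`.  It exists if `f` is antitone and vanishes
somewhere; otherwise the value is `⊥`. -/
noncomputable def ofRowLen (f : ℕ → ℕ) : YoungDiagram :=
  if h : ∃ μ : YoungDiagram, ∀ i, μ.rowLen i = f i then h.choose else ⊥

theorem rowLen_ofRowLen {f : ℕ → ℕ} (hf : Antitone f) {n : ℕ} (hn : f n = 0) (i : ℕ) :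
    (ofRowLen f).rowLen i = f i := by
  have h : ∃ μ : YoungDiagram, ∀ i, μ.rowLen i = f i := by
    have hlow : IsLowerSet
        (({p ∈ Finset.range n ×ˢ Finset.range (f 0) | p.2 < f p.1} : Finset (ℕ × ℕ)) :
          Set (ℕ × ℕ)) := by
      rintro ⟨i, j⟩ ⟨k, l⟩ ⟨hk : k ≤ i, hl : l ≤ j⟩ h
      simp only [Finset.coe_filter, Finset.mem_product, Finset.mem_range, Set.mem_ofPred_eq] at h ⊢
      have := hf hk
      omega
    refine ⟨⟨_, hlow⟩, fun i => ?_⟩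
    have key : ∀ j, j < rowLen ⟨_, hlow⟩ i ↔ j < f i := by
      intro j
      rw [← mem_iff_lt_rowLen, ← mem_cells]
      simp only [Finset.mem_filter, Finset.mem_product, Finset.mem_range]
      refine ⟨fun h => h.2, fun h => ⟨⟨?_, h.trans_le (hf (Nat.zero_le i))⟩, h⟩⟩
      by_contra! hi
      have := hf hi
      omega
    exact le_antisymm (not_lt.1 fun h => lt_irrefl _ ((key _).1 h))
      (not_lt.1 fun h => lt_irrefl _ ((key _).2 h))
  rw [ofRowLen, dif_pos h]
  exact h.choose_spec i

/-- The diagram obtained by deleting the first row. -/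
noncomputable def tail (μ : YoungDiagram) : YoungDiagram :=
  ofRowLen fun i => μ.rowLen (i + 1)

@[simp]
theorem rowLen_tail (μ : YoungDiagram) (i : ℕ) : μ.tail.rowLen i = μ.rowLen (i + 1) :=
  rowLen_ofRowLen (f := fun i => μ.rowLen (i + 1)) (fun _ _ h => μ.rowLen_anti _ _ (by omega))
    (n := μ.colLen 0)
    (Nat.le_zero.1 ((μ.rowLen_anti _ _ (Nat.le_succ _)).trans_eq μ.rowLen_colLen_zero)) i

/-- The diagram obtained by putting a row of length `t` on top; it is meaningful if
`μ.rowLen 0 ≤ t`. -/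
noncomputable def cons (t : ℕ) (μ : YoungDiagram) : YoungDiagram :=
  ofRowLen fun i => if i = 0 then t else μ.rowLen (i - 1)

theorem rowLen_cons {t : ℕ} {μ : YoungDiagram} (h : μ.rowLen 0 ≤ t) (i : ℕ) :
    (cons t μ).rowLen i = if i = 0 then t else μ.rowLen (i - 1) := by
  refine rowLen_ofRowLen (f := fun i => if i = 0 then t else μ.rowLen (i - 1))
    (antitone_nat_of_succ_le fun n => ?_) (n := μ.colLen 0 + 1) (by simp [rowLen_colLen_zero]) i
  rcases n with _ | n
  · simpa using h
  · simpa using μ.rowLen_anti n (n + 1) (Nat.le_succ n)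

/-- `μ.Interlaces ν` says that `ν / μ` is a horizontal strip. -/
def Interlaces (μ ν : YoungDiagram) : Prop :=
  ∀ i, ν.rowLen (i + 1) ≤ μ.rowLen i ∧ μ.rowLen i ≤ ν.rowLen i

theorem Interlaces.le {μ ν : YoungDiagram} (h : μ.Interlaces ν) : μ ≤ ν :=
  le_iff_rowLen_le.2 fun i => (h i).2

theorem Interlaces.card_le {μ ν : YoungDiagram} (h : μ.Interlaces ν) : μ.card ≤ ν.card :=
  Finset.card_le_card h.le

theorem mem_partitionsInBox {μ : YoungDiagram} {a b : ℕ} :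
    μ ∈ partitionsInBox a b ↔ μ.rowLen a = 0 ∧ μ.rowLen 0 ≤ b := by
  rw [partitionsInBox, Set.Finite.mem_toFinset]
  constructor
  · intro h
    constructor
    · by_contra h0
      exact lt_irrefl _ (h (a, 0) (mem_iff_lt_rowLen.2 (Nat.pos_of_ne_zero h0))).1
    · by_contra! h0
      exact lt_irrefl _ (h (0, b) (mem_iff_lt_rowLen.2 h0)).2
  · rintro ⟨h1, h2⟩ ⟨i, j⟩ hij
    have h := mem_iff_lt_rowLen.1 ((mem_cells _).1 hij)
    refine ⟨?_, h.trans_le ((μ.rowLen_anti 0 i (Nat.zero_le i)).trans h2)⟩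
    by_contra! hi
    have := μ.rowLen_anti a i hi
    omega

theorem partitionsInBox_zero_left (c : ℕ) : partitionsInBox 0 c = {⊥} := by
  ext μ
  rw [mem_partitionsInBox, Finset.mem_singleton, eq_bot_iff_rowLen_zero]
  omega

theorem Interlaces.mem_partitionsInBox {μ ν : YoungDiagram} (h : μ.Interlaces ν) {a c : ℕ}
    (hν : ν ∈ partitionsInBox a c) : μ ∈ partitionsInBox a c := by
  rw [YoungDiagram.mem_partitionsInBox] at hν ⊢
  have h1 := h a
  have h2 := h 0
  omega

open Classical in
/-- The finite set of the `μ` such that `ν / μ` is a horizontal strip. -/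
noncomputable def interlacing (ν : YoungDiagram) : Finset YoungDiagram :=
  {μ ∈ partitionsInBox (ν.colLen 0) (ν.rowLen 0) | μ.Interlaces ν}

@[simp]
theorem mem_interlacing {μ ν : YoungDiagram} : μ ∈ ν.interlacing ↔ μ.Interlaces ν := by
  classical
  rw [interlacing, Finset.mem_filter, and_iff_right_iff_imp]
  intro h
  have h1 := h (ν.colLen 0)
  have h2 := h 0
  rw [rowLen_colLen_zero] at h1
  exact YoungDiagram.mem_partitionsInBox.2 ⟨by omega, by omega⟩

open Classical in
theorem interlacing_eq_filter {ν : YoungDiagram} {a c : ℕ} (hν : ν ∈ partitionsInBox a c) :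
    ν.interlacing = {μ ∈ partitionsInBox a c | μ.Interlaces ν} := by
  ext μ
  rw [mem_interlacing, Finset.mem_filter]
  exact ⟨fun h => ⟨h.mem_partitionsInBox hν, h⟩, fun h => h.2⟩

/-- Deleting the first row is a bijection from the diagrams with first row `s` to the diagrams with
first row at most `s`. -/
theorem sum_partitionsInBox_succ_filter {M : Type*} [AddCommMonoid M] {b c s : ℕ} (hs : s ≤ c)
    (F : YoungDiagram → M) :
    ∑ g ∈ partitionsInBox (b + 1) c with s = g.rowLen 0, F g.tail =
      ∑ g ∈ partitionsInBox b c with g.rowLen 0 ≤ s, F g := by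
  refine Finset.sum_nbij' tail (cons s) ?_ ?_ ?_ ?_ (fun _ _ => rfl)
  · intro g hg
    simp only [Finset.mem_filter, mem_partitionsInBox, rowLen_tail] at hg ⊢
    have := g.rowLen_anti 0 1 (by omega)
    refine ⟨⟨hg.1.1, ?_⟩, ?_⟩ <;> simp only [zero_add] <;> omega
  · intro g hg
    simp only [Finset.mem_filter, mem_partitionsInBox] at hg ⊢
    simp [rowLen_cons hg.2, hg.1.1, hs]
  · intro g hg
    simp only [Finset.mem_filter] at hg
    have hle : g.tail.rowLen 0 ≤ s := by
      rw [hg.2, rowLen_tail]; exact g.rowLen_anti _ _ (by omega)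
    refine ext_rowLen fun i => ?_
    rw [rowLen_cons hle]
    rcases i with _ | i
    · simpa using hg.2
    · simp
  · intro g hg
    simp only [Finset.mem_filter] at hg
    exact ext_rowLen fun i => by simp [rowLen_cons hg.2]

end YoungDiagram

open YoungDiagram

/-! ### The branching rule for Schur polynomials -/

/-- Extends a filling of `α` by the letter `0` on the cells outside `α`, shifting the letters in `α`
up by one. -/
def extendFilling {α ν : YoungDiagram} {n : ℕ} (T : α.cells → Fin n) (p : ν.cells) : Fin (n + 1) :=
  if h : p.1 ∈ α.cells then (T ⟨p.1, h⟩).succ else 0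

theorem extendFilling_eq_zero_iff {α ν : YoungDiagram} {n : ℕ} {T : α.cells → Fin n}
    {p : ν.cells} : extendFilling T p = 0 ↔ p.1 ∉ α.cells := by
  unfold extendFilling
  split_ifs with h <;> simp [h, Fin.succ_ne_zero]

theorem IsColumnStrict.extendFilling {α ν : YoungDiagram} (h : α.Interlaces ν) {n : ℕ}
    {T : α.cells → Fin n} (hT : IsColumnStrict α T) :
    IsColumnStrict ν (extendFilling T) := by
  constructor
  · rintro ⟨⟨i, j⟩, hp⟩ ⟨⟨i', j'⟩, hq⟩ (rfl : i = i') (hj : j ≤ j')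
    by_cases hq' : (i, j') ∈ α.cells
    · have hp' : (i, j) ∈ α.cells := α.up_left_mem le_rfl hj hq'
      simp only [_root_.extendFilling, hq', hp', dif_pos, Fin.succ_le_succ_iff]
      exact hT.1 ⟨_, hp'⟩ ⟨_, hq'⟩ rfl hj
    · rw [extendFilling_eq_zero_iff.2 hq']
      exact Fin.zero_le _
  · rintro ⟨⟨i, j⟩, hp⟩ ⟨⟨i', j'⟩, hq⟩ (rfl : j = j') (hi : i < i')
    by_cases hq' : (i', j) ∈ α.cells
    · have hp' : (i, j) ∈ α.cells := α.up_left_mem hi.le le_rfl hq'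
      simp only [_root_.extendFilling, hq', hp', dif_pos, Fin.succ_lt_succ_iff]
      exact hT.2 ⟨_, hp'⟩ ⟨_, hq'⟩ rfl hi
    · rw [extendFilling_eq_zero_iff.2 hq', Fin.pos_iff_ne_zero, Ne, extendFilling_eq_zero_iff,
        not_not, mem_cells, mem_iff_lt_rowLen]
      rw [mem_cells, mem_iff_lt_rowLen] at hq
      exact (hq.trans_le (ν.rowLen_anti _ _ hi)).trans_le (h i).1

/-- The cells with a nonzero letter form a diagram `α` such that `ν / α` is a horizontal strip. -/
theorem IsColumnStrict.exists_eq_extendFilling {ν : YoungDiagram} {n : ℕ}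
    {T : ν.cells → Fin (n + 1)} (hT : IsColumnStrict ν T) :
    ∃ α : YoungDiagram, α.Interlaces ν ∧ ∃ S : α.cells → Fin n, IsColumnStrict α S ∧
      T = _root_.extendFilling S := by
  have hmem : ∀ p, p ∈ ({p | T p ≠ 0} : Finset ν.cells).map (Function.Embedding.subtype _) ↔
      ∃ h : p ∈ ν.cells, T ⟨p, h⟩ ≠ 0 := by
    intro p
    simp
  have hlow : IsLowerSet ((({p | T p ≠ 0} : Finset ν.cells).map
      (Function.Embedding.subtype _) : Finset (ℕ × ℕ)) : Set (ℕ × ℕ)) := by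
    rintro ⟨i, j⟩ ⟨i', j'⟩ ⟨hi : i' ≤ i, hj : j' ≤ j⟩ hp
    rw [Finset.mem_coe, hmem] at hp ⊢
    obtain ⟨hp, hp0⟩ := hp
    have h1 : (i', j) ∈ ν.cells := ν.up_left_mem hi le_rfl hp
    have h2 : (i', j') ∈ ν.cells := ν.up_left_mem le_rfl hj h1
    refine ⟨h2, ?_⟩
    rw [← Fin.pos_iff_ne_zero] at hp0 ⊢
    refine lt_of_lt_of_le ?_ (hT.1 ⟨_, h2⟩ ⟨_, h1⟩ rfl hj)
    rcases hi.lt_or_eq with hi | rfl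
    · exact hp0.trans (hT.2 ⟨_, h1⟩ ⟨_, hp⟩ rfl hi)
    · exact hp0
  set α : YoungDiagram := ⟨_, hlow⟩ with hα
  have hmem' : ∀ p, p ∈ α ↔ ∃ h : p ∈ ν.cells, T ⟨p, h⟩ ≠ 0 := hmem
  have hle : α ≤ ν := fun p hp => ((hmem' p).1 hp).1
  refine ⟨α, fun i => ⟨?_, le_iff_rowLen_le.1 hle i⟩,
    fun p => (T ⟨p.1, hle p.2⟩).pred ((hmem' p.1).1 p.2).2, ⟨?_, ?_⟩, ?_⟩
  · by_contra! hlt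
    have h1 : (i + 1, α.rowLen i) ∈ ν.cells := mem_iff_lt_rowLen.2 hlt
    have h2 : (i, α.rowLen i) ∈ ν.cells := ν.up_left_mem (Nat.le_succ i) le_rfl h1
    have h3 : (i, α.rowLen i) ∈ α :=
      (hmem' _).2 ⟨h2,
        ((Fin.zero_le _).trans_lt (hT.2 ⟨_, h2⟩ ⟨_, h1⟩ rfl (Nat.lt_succ_self i))).ne'⟩
    exact lt_irrefl _ (mem_iff_lt_rowLen.1 h3)
  · intro p q h1 h2
    exact Fin.pred_le_pred_iff.2 (hT.1 ⟨p.1, hle p.2⟩ ⟨q.1, hle q.2⟩ h1 h2)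
  · intro p q h1 h2
    exact Fin.pred_lt_pred_iff.2 (hT.2 ⟨p.1, hle p.2⟩ ⟨q.1, hle q.2⟩ h1 h2)
  · funext p
    unfold _root_.extendFilling
    split_ifs with h
    · simp
    · by_contra h0
      exact h ((hmem' _).2 ⟨p.2, h0⟩)

theorem prod_extendFilling {R : Type*} [CommRing R] {α ν : YoungDiagram} (h : α ≤ ν) {n : ℕ}
    (T : α.cells → Fin n) (x : ℕ → R) :
    ∏ p : ν.cells, x (extendFilling T p) =
      x 0 ^ (ν.card - α.card) * ∏ p : α.cells, x (T p + 1) := by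
  have hsub : α.cells ⊆ ν.cells := h
  let F : ℕ × ℕ → R := fun p => if h : p ∈ α.cells then x (T ⟨p, h⟩ + 1) else x 0
  have h1 : ∏ p : ν.cells, x (extendFilling T p) = ∏ p ∈ ν.cells, F p := by
    rw [← Finset.prod_coe_sort ν.cells F]
    refine Finset.prod_congr rfl fun p _ => ?_
    unfold extendFilling
    by_cases hp : p.1 ∈ α.cells <;> simp only [F, hp, dif_pos, dif_neg, not_false_eq_true] <;> simp
  have h2 : ∏ p : α.cells, x (T p + 1) = ∏ p ∈ α.cells, F p := by
    rw [← Finset.prod_coe_sort α.cells F]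
    exact Finset.prod_congr rfl fun p _ => by simp only [F, p.2, dif_pos]
  rw [h1, h2, ← Finset.prod_sdiff hsub]
  congr 1
  rw [Finset.prod_congr rfl fun p hp => (dif_neg (Finset.mem_sdiff.1 hp).2 : F p = x 0),
    Finset.prod_const, Finset.card_sdiff_of_subset hsub]

/-- The branching rule: the cells with the smallest letter of a column-strict plane partition form a
horizontal strip at the outer boundary of its shape. -/
theorem schurPoly_succ {R : Type*} [CommRing R] (ν : YoungDiagram) (n : ℕ) (x : ℕ → R) :
    schurPoly ν (n + 1) x =
      ∑ α ∈ ν.interlacing, x 0 ^ (ν.card - α.card) * schurPoly α n (fun i => x (i + 1)) := by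
  classical
  simp only [schurPoly, Finset.mul_sum]
  rw [Finset.sum_sigma']
  symm
  refine Finset.sum_bij (fun p _ => extendFilling p.2) ?_ ?_ ?_ ?_
  · rintro ⟨α, T⟩ h
    simp only [Finset.mem_sigma, mem_interlacing, Finset.mem_filter, Finset.mem_univ,
      true_and] at h ⊢
    exact h.2.extendFilling h.1
  · rintro ⟨α, T⟩ h ⟨β, S⟩ h' heq
    simp only [Finset.mem_sigma, mem_interlacing, Finset.mem_filter, Finset.mem_univ,
      true_and] at h h' heq
    have hcells : ∀ p, p ∈ α.cells ↔ p ∈ β.cells := by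
      intro p
      by_cases hp : p ∈ ν.cells
      · rw [← not_iff_not, ← extendFilling_eq_zero_iff (T := T) (p := ⟨p, hp⟩), heq,
          extendFilling_eq_zero_iff]
      · exact iff_of_false (fun h1 => hp (h.1.le h1)) (fun h1 => hp (h'.1.le h1))
    obtain rfl : α = β := YoungDiagram.ext (Finset.ext hcells)
    obtain rfl : T = S := by
      funext p
      have := congrFun heq ⟨p.1, h.1.le p.2⟩
      simpa [extendFilling] using this
    rfl
  · intro T hT
    simp only [Finset.mem_filter, Finset.mem_univ, true_and] at hT
    obtain ⟨α, hα, S, hS, rfl⟩ := hT.exists_eq_extendFilling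
    exact ⟨⟨α, S⟩, by simp [hα, hS], rfl⟩
  · rintro ⟨α, T⟩ h
    simp only [Finset.mem_sigma, mem_interlacing] at h
    exact (prod_extendFilling h.1.le T x).symm

open Classical in
theorem schurPoly_zero {R : Type*} [CommRing R] (ν : YoungDiagram) (x : ℕ → R) :
    schurPoly ν 0 x = if ν = ⊥ then 1 else 0 := by
  rw [schurPoly]
  split_ifs with h
  · subst h
    have : IsEmpty (⊥ : YoungDiagram).cells := ⟨fun p => notMem_bot _ p.2⟩
    rw [Finset.filter_true_of_mem fun T _ => ⟨fun p => isEmptyElim p, fun p => isEmptyElim p⟩]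
    simp
  · have : Nonempty ν.cells := by
      rw [eq_bot_iff_rowLen_zero] at h
      exact ⟨⟨(0, 0), mem_iff_lt_rowLen.2 (Nat.pos_of_ne_zero h)⟩⟩
    exact Finset.sum_eq_zero fun T _ => (T (Classical.arbitrary _)).elim0

/-- The columns of the shape cannot be longer than the number of letters. -/
theorem schurPoly_eq_zero {R : Type*} [CommRing R] {ν : YoungDiagram} {n : ℕ}
    (h : ν.rowLen n ≠ 0) (x : ℕ → R) : schurPoly ν n x = 0 := by
  induction n generalizing ν x with
  | zero => rw [schurPoly_zero, if_neg (mt eq_bot_iff_rowLen_zero.1 h)]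
  | succ n ih =>
    rw [schurPoly_succ]
    refine Finset.sum_eq_zero fun α hα => ?_
    have := (mem_interlacing.1 hα n).1
    rw [ih (by omega), mul_zero]

/-! ### The local rule for growth diagrams -/

namespace YoungDiagram

/-- The diagram with rows `min(α_i, μ_i) + max(α_{i+1}, μ_{i+1}) - ν_{i+1}`, obtained from `ν` by
the backward local rule.  If `α` and `μ` interlace with `ν`, the subtraction does not truncate and
the rows are weakly decreasing. -/
noncomputable def localDown (α μ ν : YoungDiagram) : YoungDiagram :=
  ofRowLen fun i => min (α.rowLen i) (μ.rowLen i) + max (α.rowLen (i + 1)) (μ.rowLen (i + 1)) -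
    ν.rowLen (i + 1)

/-- The diagram with first row `t` and further rows
`min(α_i, μ_i) + max(α_{i+1}, μ_{i+1}) - γ_i`, obtained from `γ` by the forward local rule.  If `γ`
interlaces with `α` and `μ` and `max(α_0, μ_0) ≤ t`, the subtraction does not truncate and the rows
are weakly decreasing. -/
noncomputable def localUp (t : ℕ) (α μ γ : YoungDiagram) : YoungDiagram :=
  ofRowLen fun i => if i = 0 then t else
    min (α.rowLen (i - 1)) (μ.rowLen (i - 1)) + max (α.rowLen i) (μ.rowLen i) - γ.rowLen (i - 1)

theorem rowLen_localDown {α μ ν : YoungDiagram} (hα : α.Interlaces ν) (hμ : μ.Interlaces ν)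
    (i : ℕ) :
    (localDown α μ ν).rowLen i = min (α.rowLen i) (μ.rowLen i) +
      max (α.rowLen (i + 1)) (μ.rowLen (i + 1)) - ν.rowLen (i + 1) := by
  refine rowLen_ofRowLen (f := fun i => min (α.rowLen i) (μ.rowLen i) +
    max (α.rowLen (i + 1)) (μ.rowLen (i + 1)) - ν.rowLen (i + 1))
    (antitone_nat_of_succ_le fun n => ?_) (n := ν.colLen 0) ?_ i
  · have h1 := hα n; have h2 := hμ n; have h3 := hα (n + 1); have h4 := hμ (n + 1)
    have h5 := hα (n + 1 + 1); have h6 := hμ (n + 1 + 1)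
    omega
  · have h1 := hα (ν.colLen 0); have h2 := hμ (ν.colLen 0)
    have h3 := hα (ν.colLen 0 + 1); have h4 := hμ (ν.colLen 0 + 1)
    have h5 := ν.rowLen_colLen_zero
    omega

theorem rowLen_localUp {t : ℕ} {α μ γ : YoungDiagram} (hα : γ.Interlaces α)
    (hμ : γ.Interlaces μ) (ht : max (α.rowLen 0) (μ.rowLen 0) ≤ t) (i : ℕ) :
    (localUp t α μ γ).rowLen i = if i = 0 then t else
      min (α.rowLen (i - 1)) (μ.rowLen (i - 1)) + max (α.rowLen i) (μ.rowLen i) -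
        γ.rowLen (i - 1) := by
  refine rowLen_ofRowLen (f := fun i => if i = 0 then t else
    min (α.rowLen (i - 1)) (μ.rowLen (i - 1)) + max (α.rowLen i) (μ.rowLen i) - γ.rowLen (i - 1))
    (antitone_nat_of_succ_le fun n => ?_) (n := α.colLen 0 + 1) ?_ i
  · have h1 := hα n; have h2 := hμ n
    rcases n with _ | n
    · simp only [zero_add, one_ne_zero, if_false, if_true, Nat.sub_self] at h1 h2 ⊢
      omega
    · have h3 := hα n; have h4 := hμ n
      simp only [Nat.add_eq_zero_iff, one_ne_zero, and_false, if_false, Nat.add_sub_cancel]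
      omega
  · have h1 := hα (α.colLen 0); have h2 := hμ (α.colLen 0)
    have h3 := α.rowLen_colLen_zero
    simp only [Nat.add_eq_zero_iff, one_ne_zero, and_false, if_false, Nat.add_sub_cancel]
    omega

/-- If `ν` and `γ` correspond under the local rule, their sizes satisfy
`|ν| + |γ| + max(α_0, μ_0) = ν_0 + |α| + |μ|`. -/
theorem card_add_card_of_localRule {α μ ν γ : YoungDiagram}
    (h : ∀ i, ν.rowLen (i + 1) + γ.rowLen i =
      min (α.rowLen i) (μ.rowLen i) + max (α.rowLen (i + 1)) (μ.rowLen (i + 1))) :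
    ν.card + γ.card + max (α.rowLen 0) (μ.rowLen 0) = ν.rowLen 0 + α.card + μ.card := by
  obtain ⟨n, hα, hμ, hν, hγ⟩ : ∃ n, α.rowLen n = 0 ∧ μ.rowLen n = 0 ∧ ν.rowLen (n + 1) = 0 ∧
      γ.rowLen n = 0 := by
    refine ⟨max (α.colLen 0) (μ.colLen 0), ?_⟩
    have h1 := α.rowLen_anti _ _ (le_max_left (α.colLen 0) (μ.colLen 0))
    have h2 := μ.rowLen_anti _ _ (le_max_right (α.colLen 0) (μ.colLen 0))
    rw [rowLen_colLen_zero] at h1 h2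
    have h3 := α.rowLen_anti _ _ (Nat.le_succ (max (α.colLen 0) (μ.colLen 0)))
    have h4 := μ.rowLen_anti _ _ (Nat.le_succ (max (α.colLen 0) (μ.colLen 0)))
    have h5 := h (max (α.colLen 0) (μ.colLen 0))
    simp only [Nat.succ_eq_add_one] at h3 h4
    omega
  rw [ν.card_eq_sum_rowLen hν, γ.card_eq_sum_rowLen hγ, α.card_eq_sum_rowLen hα,
    μ.card_eq_sum_rowLen hμ, Finset.sum_range_succ']
  have key : ∀ k, ∑ i ∈ Finset.range k, ν.rowLen (i + 1) + ∑ i ∈ Finset.range k, γ.rowLen i +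
      max (α.rowLen 0) (μ.rowLen 0) = ∑ i ∈ Finset.range k, α.rowLen i +
        ∑ i ∈ Finset.range k, μ.rowLen i + max (α.rowLen k) (μ.rowLen k) := by
    -- The last term makes the sums telescope; it vanishes at `k = n`.
    intro k
    induction k with
    | zero => simp
    | succ k ih =>
      simp only [Finset.sum_range_succ]
      have := h k
      omega
  have := key n
  omega

open Classical in
/-- The skew Cauchy identity for horizontal strips, refined by the first row `t` of the larger
diagrams. -/
theorem sum_localRule {R : Type*} [CommRing R] (x z : R) {a c t : ℕ} {α μ : YoungDiagram}
    (hα : α ∈ partitionsInBox (a + 1) c) (hμ : μ.rowLen a = 0) (htc : t ≤ c)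
    (ht : max (α.rowLen 0) (μ.rowLen 0) ≤ t) :
    ∑ ν ∈ partitionsInBox (a + 1) c with (μ.Interlaces ν ∧ α.Interlaces ν) ∧ ν.rowLen 0 = t,
        x ^ (ν.card - μ.card) * z ^ (ν.card - α.card) =
      (x * z) ^ (t - max (α.rowLen 0) (μ.rowLen 0)) *
        ∑ γ ∈ μ.interlacing with γ.Interlaces α,
          x ^ (α.card - γ.card) * z ^ (μ.card - γ.card) := by
  rw [Finset.mul_sum]
  have hα1 := (mem_partitionsInBox.1 hα).1
  have down : ∀ ν, μ.Interlaces ν → α.Interlaces ν → ν.rowLen 0 = t →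
      (localDown α μ ν).Interlaces μ ∧ (localDown α μ ν).Interlaces α := by
    intro ν h1 h2 _
    constructor <;> intro i <;> rw [rowLen_localDown h2 h1] <;>
    · have h3 := h1 i; have h4 := h2 i; have h5 := h1 (i + 1); have h6 := h2 (i + 1)
      omega
  have up : ∀ γ, γ.Interlaces μ → γ.Interlaces α →
      μ.Interlaces (localUp t α μ γ) ∧ α.Interlaces (localUp t α μ γ) := by
    intro γ h1 h2
    constructor <;> intro i <;> rw [rowLen_localUp h2 h1 ht, rowLen_localUp h2 h1 ht] <;>
    · have h3 := h1 i; have h4 := h2 i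
      rcases i with _ | i
      · simp only [zero_add, one_ne_zero, if_false, if_true, Nat.sub_self] at h3 h4 ⊢
        omega
      · have h5 := h1 i; have h6 := h2 i
        simp only [Nat.add_eq_zero_iff, one_ne_zero, and_false, if_false, Nat.add_sub_cancel]
        omega
  refine Finset.sum_nbij' (localDown α μ) (localUp t α μ) ?_ ?_ ?_ ?_ ?_
  · intro ν hν
    simp only [Finset.mem_filter, mem_interlacing] at hν ⊢
    exact down ν hν.2.1.1 hν.2.1.2 hν.2.2
  · intro γ hγ
    simp only [Finset.mem_filter, mem_interlacing, mem_partitionsInBox] at hγ ⊢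
    refine ⟨⟨?_, ?_⟩, up γ hγ.1 hγ.2, ?_⟩
    · rw [rowLen_localUp hγ.2 hγ.1 ht]
      simp only [Nat.add_eq_zero_iff, one_ne_zero, and_false, if_false, Nat.add_sub_cancel]
      have := μ.rowLen_anti a (a + 1) (Nat.le_succ a)
      omega
    · simpa [rowLen_localUp hγ.2 hγ.1 ht] using htc
    · simp [rowLen_localUp hγ.2 hγ.1 ht]
  · intro ν hν
    simp only [Finset.mem_filter] at hν
    obtain ⟨h1, h2⟩ := down ν hν.2.1.1 hν.2.1.2 hν.2.2
    refine ext_rowLen fun i => ?_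
    rw [rowLen_localUp h2 h1 ht]
    rcases i with _ | i
    · simp [hν.2.2]
    · simp only [Nat.add_eq_zero_iff, one_ne_zero, and_false, if_false, Nat.add_sub_cancel]
      rw [rowLen_localDown hν.2.1.2 hν.2.1.1]
      have h3 := hν.2.1.1 i; have h4 := hν.2.1.2 i
      omega
  · intro γ hγ
    simp only [Finset.mem_filter, mem_interlacing] at hγ
    obtain ⟨h1, h2⟩ := up γ hγ.1 hγ.2
    refine ext_rowLen fun i => ?_
    rw [rowLen_localDown h2 h1, rowLen_localUp hγ.2 hγ.1 ht]
    simp only [Nat.add_eq_zero_iff, one_ne_zero, and_false, if_false, Nat.add_sub_cancel]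
    have h3 := hγ.1 i; have h4 := hγ.2 i
    omega
  · intro ν hν
    simp only [Finset.mem_filter] at hν
    obtain ⟨-, ⟨h1, h2⟩, h3⟩ := hν
    obtain ⟨h4, h5⟩ := down ν h1 h2 h3
    have hcard := card_add_card_of_localRule (α := α) (μ := μ) (ν := ν) (γ := localDown α μ ν) (by
      intro i
      rw [rowLen_localDown h2 h1]
      have h6 := h1 i; have h7 := h2 i
      omega)
    have := h1.card_le; have := h2.card_le; have := h4.card_le; have := h5.card_le
    rw [mul_pow, mul_mul_mul_comm, ← pow_add, ← pow_add]
    congr 2 <;> omega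

end YoungDiagram

/-! ### Chains of interlacing partitions and last passage percolation -/

open Classical in
/-- The generating polynomial of the column-strict plane partitions of shape `ν` with `b` letters,
in the variables `z`, such that the first rows of the successive inner shapes (starting from `ν`
and removing the cells with the smallest letter each time) are the rows of `G`. -/
noncomputable def chainPoly {R : Type*} [CommRing R] :
    (b : ℕ) → (ℕ → R) → YoungDiagram → YoungDiagram → R
  | 0, _, ν, _ => if ν = ⊥ then 1 else 0
  | b + 1, z, ν, G =>
    if ν.rowLen 0 = G.rowLen 0 then
      ∑ α ∈ ν.interlacing,
        z 0 ^ (ν.card - α.card) * chainPoly b (fun j => z (j + 1)) α G.tail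
    else 0

open Classical in
/-- The one-step transition weight of last passage percolation: the row `G` arises from the row `g`
by adding the entries `w_j = G_j - max(G_{j+1}, g_j)`, each weighted by `(x z_j)^{w_j}`. -/
noncomputable def rowWeight {R : Type*} [CommRing R] (b : ℕ) (x : R) (z : ℕ → R)
    (g G : YoungDiagram) : R :=
  if g ≤ G then
    ∏ j ∈ Finset.range b, (x * z j) ^ (G.rowLen j - max (G.rowLen (j + 1)) (g.rowLen j))
  else 0

section Chain

variable {R : Type*} [CommRing R]

/-- Chains are recorded with their true first parts: the first row of `G` is that of `ν`. -/
theorem chainPoly_eq_zero {b c : ℕ} {z : ℕ → R} {ν G : YoungDiagram}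
    (hG : G ∈ partitionsInBox b c) (h : ν.rowLen 0 ≠ G.rowLen 0) : chainPoly b z ν G = 0 := by
  cases b with
  | zero =>
    rw [partitionsInBox_zero_left, Finset.mem_singleton] at hG
    subst hG
    rw [chainPoly, if_neg]
    rintro rfl
    exact h rfl
  | succ b => rw [chainPoly, if_neg h]

theorem tail_mem_partitionsInBox {b c : ℕ} {G : YoungDiagram}
    (hG : G ∈ partitionsInBox (b + 1) c) : G.tail ∈ partitionsInBox b c := by
  rw [mem_partitionsInBox] at hG ⊢
  have := G.rowLen_anti 0 1 (Nat.le_succ 0)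
  rw [rowLen_tail, rowLen_tail]
  exact ⟨hG.1, this.trans hG.2⟩

theorem sum_chainPoly_eq_schurPoly (b c : ℕ) (z : ℕ → R) (ν : YoungDiagram)
    (hν : ν.rowLen 0 ≤ c) : ∑ G ∈ partitionsInBox b c, chainPoly b z ν G = schurPoly ν b z := by
  classical
  induction b generalizing z ν with
  | zero => simp [partitionsInBox_zero_left, chainPoly, schurPoly_zero]
  | succ b ih =>
    simp only [chainPoly, ← Finset.sum_filter]
    rw [sum_partitionsInBox_succ_filter hν (fun G => ∑ α ∈ ν.interlacing,
        z 0 ^ (ν.card - α.card) * chainPoly b (fun j => z (j + 1)) α G),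
      Finset.sum_comm, schurPoly_succ]
    refine Finset.sum_congr rfl fun α hα => ?_
    have hαν := (mem_interlacing.1 hα 0).2
    rw [← ih _ α (hαν.trans hν), Finset.mul_sum, Finset.sum_filter_of_ne]
    intro G hG hne
    by_contra hlt
    exact hne (by rw [chainPoly_eq_zero hG (by omega), mul_zero])

theorem rowWeight_succ (b : ℕ) (x : R) (z : ℕ → R) (g G : YoungDiagram) :
    rowWeight (b + 1) x z g G =
      if g.rowLen 0 ≤ G.rowLen 0 then
        (x * z 0) ^ (G.rowLen 0 - max (G.rowLen 1) (g.rowLen 0)) *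
          rowWeight b x (fun j => z (j + 1)) g.tail G.tail
      else 0 := by
  have hiff : g ≤ G ↔ g.rowLen 0 ≤ G.rowLen 0 ∧ g.tail ≤ G.tail := by
    simp only [le_iff_rowLen_le, rowLen_tail]
    refine ⟨fun h => ⟨h 0, fun i => h (i + 1)⟩, fun h i => ?_⟩
    rcases i with _ | i
    exacts [h.1, h.2 i]
  unfold rowWeight
  rw [hiff]
  by_cases h1 : g.rowLen 0 ≤ G.rowLen 0 <;> by_cases h2 : g.tail ≤ G.tail <;>
    simp [h1, h2, Finset.prod_range_succ', mul_comm]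

open Classical in
/-- Adding a horizontal strip on the outside transforms the first rows along a chain like one step
of last passage percolation. -/
theorem sum_interlaces_chainPoly (a b c : ℕ) (x : R) (z : ℕ → R) (μ G : YoungDiagram)
    (hμ : μ ∈ partitionsInBox a c) (hG : G ∈ partitionsInBox b c) :
    ∑ ν ∈ partitionsInBox (a + 1) c with μ.Interlaces ν,
        x ^ (ν.card - μ.card) * chainPoly b z ν G =
      ∑ g ∈ partitionsInBox b c, chainPoly b z μ g * rowWeight b x z g G := by
  have hμ' := mem_partitionsInBox.1 hμ
  induction b generalizing z μ G with
  | zero =>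
    rw [partitionsInBox_zero_left, Finset.mem_singleton] at hG
    subst hG
    have hbot : (⊥ : YoungDiagram) ∈ partitionsInBox (a + 1) c := by simp [mem_partitionsInBox]
    have hiff : μ.Interlaces ⊥ ↔ μ = ⊥ := by
      refine ⟨fun h => le_bot_iff.1 h.le, ?_⟩
      rintro rfl i
      simp
    simp only [chainPoly, mul_ite, mul_one, mul_zero, Finset.sum_ite_eq', Finset.mem_filter, hbot,
      true_and, hiff, partitionsInBox_zero_left, Finset.sum_singleton, rowWeight, le_refl, if_true,
      Finset.range_zero, Finset.prod_empty]
    split_ifs with h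
    · rw [h, Nat.sub_self, pow_zero]
    · rfl
  | succ b ih =>
    have hG' := mem_partitionsInBox.1 hG
    have hT := tail_mem_partitionsInBox hG
    have hG01 := G.rowLen_anti 0 1 (Nat.le_succ 0)
    set z' : ℕ → R := fun j => z (j + 1) with hz'
    -- The local rule applies with `α_0` replaced by `G_1`: the chain polynomial of `α` and `G.tail`
    -- vanishes unless these agree, and `G_1 ≤ G_0` makes the bound on `α_0` automatic.
    have inner : ∀ α ∈ partitionsInBox (a + 1) c,
        (∑ ν ∈ partitionsInBox (a + 1) c with
            (μ.Interlaces ν ∧ α.Interlaces ν) ∧ ν.rowLen 0 = G.rowLen 0,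
          x ^ (ν.card - μ.card) * z 0 ^ (ν.card - α.card)) * chainPoly b z' α G.tail =
        if μ.rowLen 0 ≤ G.rowLen 0 then
          (x * z 0) ^ (G.rowLen 0 - max (G.rowLen 1) (μ.rowLen 0)) *
            (∑ γ ∈ μ.interlacing with γ.Interlaces α,
              x ^ (α.card - γ.card) * z 0 ^ (μ.card - γ.card)) * chainPoly b z' α G.tail
        else 0 := by
      intro α hα
      split_ifs with h
      · by_cases h0 : α.rowLen 0 = G.tail.rowLen 0
        · rw [rowLen_tail, zero_add] at h0
          rw [sum_localRule x (z 0) hα hμ'.1 hG'.2 (by omega), h0]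
        · rw [chainPoly_eq_zero hT h0, mul_zero, mul_zero]
      · rw [Finset.sum_eq_zero, zero_mul]
        intro ν hν
        simp only [Finset.mem_filter] at hν
        have := (hν.2.1.1 0).2
        omega
    calc ∑ ν ∈ partitionsInBox (a + 1) c with μ.Interlaces ν,
          x ^ (ν.card - μ.card) * chainPoly (b + 1) z ν G
        = ∑ α ∈ partitionsInBox (a + 1) c,
          (∑ ν ∈ partitionsInBox (a + 1) c with
            (μ.Interlaces ν ∧ α.Interlaces ν) ∧ ν.rowLen 0 = G.rowLen 0,
          x ^ (ν.card - μ.card) * z 0 ^ (ν.card - α.card)) * chainPoly b z' α G.tail := by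
          simp only [Finset.sum_filter, Finset.sum_mul]
          rw [Finset.sum_comm]
          refine Finset.sum_congr rfl fun ν hν => ?_
          rw [chainPoly, interlacing_eq_filter hν, Finset.sum_filter]
          by_cases h1 : μ.Interlaces ν <;> by_cases h2 : ν.rowLen 0 = G.rowLen 0 <;>
            simp [h1, h2, Finset.mul_sum, ite_mul, mul_assoc, hz']
      _ = if μ.rowLen 0 ≤ G.rowLen 0 then
          (x * z 0) ^ (G.rowLen 0 - max (G.rowLen 1) (μ.rowLen 0)) *
            ∑ γ ∈ μ.interlacing, z 0 ^ (μ.card - γ.card) *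
              ∑ α ∈ partitionsInBox (a + 1) c with γ.Interlaces α,
                x ^ (α.card - γ.card) * chainPoly b z' α G.tail
          else 0 := by
          rw [Finset.sum_congr rfl inner]
          split_ifs with h
          · simp only [Finset.sum_filter, Finset.sum_mul, Finset.mul_sum]
            rw [Finset.sum_comm]
            refine Finset.sum_congr rfl fun γ _ => Finset.sum_congr rfl fun α _ => ?_
            split_ifs <;> ring
          · simp
      _ = if μ.rowLen 0 ≤ G.rowLen 0 then
          (x * z 0) ^ (G.rowLen 0 - max (G.rowLen 1) (μ.rowLen 0)) *
            ∑ γ ∈ μ.interlacing, z 0 ^ (μ.card - γ.card) *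
              ∑ g ∈ partitionsInBox b c with g.rowLen 0 ≤ μ.rowLen 0,
                chainPoly b z' γ g * rowWeight b x z' g G.tail
          else 0 := by
          congr 2
          refine Finset.sum_congr rfl fun γ hγ => ?_
          have hγ' := mem_interlacing.1 hγ
          have hγb := hγ'.mem_partitionsInBox hμ
          rw [ih z' γ G.tail hγb hT (mem_partitionsInBox.1 hγb), Finset.sum_filter_of_ne]
          intro g hg hne
          by_contra hlt
          have := (hγ' 0).2
          exact hne (by rw [chainPoly_eq_zero hg (by omega), zero_mul])
      _ = ∑ g ∈ partitionsInBox (b + 1) c with μ.rowLen 0 = g.rowLen 0,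
          (if μ.rowLen 0 ≤ G.rowLen 0 then
            (x * z 0) ^ (G.rowLen 0 - max (G.rowLen 1) (μ.rowLen 0)) *
              ((∑ γ ∈ μ.interlacing, z 0 ^ (μ.card - γ.card) * chainPoly b z' γ g.tail) *
              rowWeight b x z' g.tail G.tail)
            else 0) := by
          rw [sum_partitionsInBox_succ_filter hμ'.2 (fun g =>
            if μ.rowLen 0 ≤ G.rowLen 0 then
            (x * z 0) ^ (G.rowLen 0 - max (G.rowLen 1) (μ.rowLen 0)) *
              ((∑ γ ∈ μ.interlacing, z 0 ^ (μ.card - γ.card) * chainPoly b z' γ g) *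
              rowWeight b x z' g G.tail)
            else 0)]
          split_ifs with h
          · simp only [Finset.sum_mul, Finset.mul_sum]
            rw [Finset.sum_comm]
            refine Finset.sum_congr rfl fun γ _ => Finset.sum_congr rfl fun α _ => ?_
            ring
          · simp
      _ = _ := by
          rw [Finset.sum_filter]
          refine Finset.sum_congr rfl fun g _ => ?_
          rw [chainPoly, rowWeight_succ]
          by_cases h1 : μ.rowLen 0 = g.rowLen 0
          · by_cases h2 : g.rowLen 0 ≤ G.rowLen 0
            · simp only [h1, h2, if_true, hz']
              ring
            · simp [h1, h2]
          · simp [h1]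

end Chain

/-! ### Plane partitions by rows -/

namespace PlanePartition

theorem mem_corners {π : PlanePartition} {i j k : ℕ} :
    (i, j, k) ∈ π.corners ↔
      max (π.entry (i + 1) j) (π.entry i (j + 1)) ≤ k ∧ k < π.entry i j := by
  rw [corners, Set.Finite.mem_toFinset]
  change k < π.entry i j ∧ ¬ k < π.entry (i + 1) j ∧ ¬ k < π.entry i (j + 1) ↔ _
  omega

theorem mem_withSideShape {π : PlanePartition} {a b : ℕ} {μ : YoungDiagram} :
    π ∈ withSideShape a b μ ↔
      (∀ i j, π.entry i j ≠ 0 → i < a ∧ j < b) ∧ ∀ j, π.entry 0 j = μ.rowLen j := by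
  rw [withSideShape, Set.Finite.mem_toFinset]
  rfl

/-- There are `π_{i,j} - max(π_{i+1,j}, π_{i,j+1})` corners above the position `(i, j)`. -/
theorem prod_corners {R : Type*} [CommRing R] {π : PlanePartition} {a b : ℕ}
    (h : ∀ i j, π.entry i j ≠ 0 → i < a ∧ j < b) (f : ℕ → ℕ → R) :
    ∏ p ∈ π.corners, f p.1 p.2.1 =
      ∏ i ∈ Finset.range a, ∏ j ∈ Finset.range b,
        f i j ^ (π.entry i j - max (π.entry (i + 1) j) (π.entry i (j + 1))) := by
  rw [← Finset.prod_product', ← Finset.prod_fiberwise_of_maps_to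
    (g := fun p : ℕ × ℕ × ℕ => (p.1, p.2.1)) (t := Finset.range a ×ˢ Finset.range b)]
  · refine Finset.prod_congr rfl ?_
    rintro ⟨i, j⟩ -
    have hfib : {p ∈ π.corners | (p.1, p.2.1) = (i, j)} =
        (Finset.Ico (max (π.entry (i + 1) j) (π.entry i (j + 1))) (π.entry i j)).map
          ⟨fun k => (i, j, k), fun k l hkl => by simpa using hkl⟩ := by
      ext ⟨i', j', k⟩
      simp only [Finset.mem_filter, mem_corners, Finset.mem_map, Finset.mem_Ico, Prod.mk.injEq]
      constructor
      · rintro ⟨hk, rfl, rfl⟩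
        exact ⟨k, hk, rfl⟩
      · rintro ⟨k, hk, heq⟩
        cases heq
        exact ⟨hk, rfl, rfl⟩
    rw [hfib, Finset.prod_map]
    change ∏ _k ∈ Finset.Ico _ _, f i j = _
    rw [Finset.prod_const, Nat.card_Ico]
  · rintro ⟨i, j, k⟩ hp
    have := (mem_corners.1 hp).2
    simpa using h i j (by omega)

/-- The plane partition obtained by deleting the first row. -/
def tail (π : PlanePartition) : PlanePartition where
  entry i j := π.entry (i + 1) j
  succ_row_le i j := π.succ_row_le (i + 1) j
  succ_col_le i j := π.succ_col_le (i + 1) j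
  finite_support := by
    refine π.finite_support.preimage (f := fun p : ℕ × ℕ => (p.1 + 1, p.2)) ?_
    rintro ⟨i, j⟩ - ⟨k, l⟩ - h
    simpa using h

/-- The plane partition obtained by putting the row lengths of `μ` on top, as a new first row. -/
def cons (μ : YoungDiagram) (π : PlanePartition) (h : ∀ j, π.entry 0 j ≤ μ.rowLen j) :
    PlanePartition where
  entry i j := if i = 0 then μ.rowLen j else π.entry (i - 1) j
  succ_row_le i j := by
    rcases i with _ | i
    · simpa using h j
    · simpa using π.succ_row_le i j
  succ_col_le i j := by
    split_ifs
    · exact μ.rowLen_anti _ _ (Nat.le_succ j)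
    · exact π.succ_col_le _ j
  finite_support := by
    refine ((μ.cells.finite_toSet.image Prod.fst).image (fun j => (0, j)) |>.union
      (π.finite_support.image fun p => (p.1 + 1, p.2))).subset ?_
    rintro ⟨i, j⟩ hp
    rcases i with _ | i
    · refine Or.inl ⟨j, ⟨(j, 0), ?_, rfl⟩, rfl⟩
      exact mem_iff_lt_rowLen.2 (Nat.pos_of_ne_zero hp)
    · exact Or.inr ⟨(i, j), hp, rfl⟩

end PlanePartition

section Recursion

variable {R : Type*} [CommRing R]

open Classical in
theorem dualGrothendieckPoly_zero (μ : YoungDiagram) (b : ℕ) (x z : ℕ → R) :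
    dualGrothendieckPoly μ 0 b x z = if μ = ⊥ then 1 else 0 := by
  rw [dualGrothendieckPoly]
  split_ifs with h
  · subst h
    have hsing : PlanePartition.withSideShape 0 b ⊥ =
        {⟨fun _ _ => 0, by simp, by simp, by simp⟩} := by
      ext π
      rw [PlanePartition.mem_withSideShape, Finset.mem_singleton]
      constructor
      · rintro ⟨h, -⟩
        ext i j
        by_contra h0
        exact Nat.not_lt_zero _ (h i j h0).1
      · rintro rfl
        simp
    rw [hsing, Finset.sum_singleton, PlanePartition.prod_corners (a := 0) (b := 0) (by simp)
      (fun i j => x i * z j)]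
    simp
  · refine Finset.sum_eq_zero fun π hπ => absurd ?_ h
    rw [PlanePartition.mem_withSideShape] at hπ
    rw [eq_bot_iff_rowLen_zero, ← hπ.2]
    by_contra h0
    exact Nat.not_lt_zero _ (hπ.1 0 0 h0).1

/-- Deleting the first row of a plane partition is one step of last passage percolation. -/
theorem dualGrothendieckPoly_succ (a b c : ℕ) (x z : ℕ → R) {μ : YoungDiagram}
    (hμ : μ ∈ partitionsInBox b c) :
    dualGrothendieckPoly μ (a + 1) b x z =
      ∑ ν ∈ partitionsInBox b c,
        rowWeight b (x 0) z ν μ * dualGrothendieckPoly ν a b (fun i => x (i + 1)) z := by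
  classical
  have hμ' := mem_partitionsInBox.1 hμ
  have row : ∀ π ∈ PlanePartition.withSideShape (a + 1) b μ, ∀ j,
      (ofRowLen (π.entry 1)).rowLen j = π.entry 1 j ∧ π.entry 1 j ≤ μ.rowLen j := by
    intro π hπ j
    rw [PlanePartition.mem_withSideShape] at hπ
    refine ⟨rowLen_ofRowLen (antitone_nat_of_succ_le fun j => π.succ_col_le 1 j) (n := b) ?_ j,
      (π.succ_row_le 0 j).trans_eq (hπ.2 j)⟩
    by_contra h0
    exact lt_irrefl _ (hπ.1 _ _ h0).2
  rw [dualGrothendieckPoly, ← Finset.sum_fiberwise_of_maps_to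
    (g := fun π : PlanePartition => ofRowLen (π.entry 1)) (t := partitionsInBox b c)]
  swap
  · intro π hπ
    obtain ⟨h1, h2⟩ := row π hπ b
    obtain ⟨h3, h4⟩ := row π hπ 0
    rw [mem_partitionsInBox]
    omega
  refine Finset.sum_congr rfl fun ν hν => ?_
  have hν' := mem_partitionsInBox.1 hν
  rw [rowWeight]
  split_ifs with hle
  · rw [dualGrothendieckPoly, Finset.mul_sum]
    refine Finset.sum_bij (fun π _ => π.tail) ?_ ?_ ?_ ?_
    · intro π hπ
      rw [Finset.mem_filter] at hπ
      have hr := row π hπ.1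
      rw [PlanePartition.mem_withSideShape] at hπ ⊢
      refine ⟨fun i j h => ?_, fun j => ?_⟩
      · have := hπ.1.1 (i + 1) j h
        omega
      · rw [← hπ.2, (hr j).1]
        rfl
    · intro π hπ ρ hρ heq
      rw [Finset.mem_filter, PlanePartition.mem_withSideShape] at hπ hρ
      ext i j
      rcases i with _ | i
      · rw [hπ.1.2, hρ.1.2]
      · exact congrFun (congrFun (congrArg PlanePartition.entry heq) i) j
    · intro π hπ
      rw [PlanePartition.mem_withSideShape] at hπ
      have hent : ∀ j, π.entry 0 j ≤ μ.rowLen j := fun j =>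
        (hπ.2 j).trans_le (le_iff_rowLen_le.1 hle j)
      have hmem : PlanePartition.cons μ π hent ∈ PlanePartition.withSideShape (a + 1) b μ := by
        rw [PlanePartition.mem_withSideShape]
        refine ⟨fun i j h => ?_, fun j => rfl⟩
        rcases i with _ | i
        · refine ⟨Nat.succ_pos a, ?_⟩
          by_contra! hj
          have h1 : μ.rowLen j ≠ 0 := h
          have := μ.rowLen_anti b j hj
          omega
        · have := hπ.1 i j h
          omega
      refine ⟨PlanePartition.cons μ π hent, Finset.mem_filter.2 ⟨hmem, ?_⟩, rfl⟩
      exact ext_rowLen fun j => ((row _ hmem j).1.trans (hπ.2 j))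
    · intro π hπ
      rw [Finset.mem_filter] at hπ
      have hr := row π hπ.1
      rw [PlanePartition.mem_withSideShape] at hπ
      have htail : ∀ i j, π.tail.entry i j ≠ 0 → i < a ∧ j < b := by
        intro i j h
        have := hπ.1.1 (i + 1) j h
        omega
      rw [PlanePartition.prod_corners hπ.1.1 (fun i j => x i * z j),
        PlanePartition.prod_corners htail (fun i j => x (i + 1) * z j),
        Finset.prod_range_succ', mul_comm]
      congr 1
      refine Finset.prod_congr rfl fun j _ => ?_
      rw [hπ.1.2, hπ.1.2, zero_add, ← (hr j).1, hπ.2, max_comm]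
  · rw [zero_mul]
    refine Finset.sum_eq_zero fun π hπ => absurd (le_iff_rowLen_le.2 fun j => ?_) hle
    rw [Finset.mem_filter] at hπ
    rw [← hπ.2, (row π hπ.1 j).1]
    exact (row π hπ.1 j).2

open Classical in
theorem chainPoly_bot {b c : ℕ} (z : ℕ → R) {G : YoungDiagram} (hG : G ∈ partitionsInBox b c) :
    chainPoly b z ⊥ G = if G = ⊥ then 1 else 0 := by
  induction b generalizing z G with
  | zero =>
    rw [partitionsInBox_zero_left, Finset.mem_singleton] at hG
    simp [chainPoly, hG]
  | succ b ih =>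
    have hint : (⊥ : YoungDiagram).interlacing = {⊥} := by
      ext α
      rw [mem_interlacing, Finset.mem_singleton]
      refine ⟨fun h => le_bot_iff.1 h.le, ?_⟩
      rintro rfl i
      simp
    rw [chainPoly, hint, Finset.sum_singleton, ih _ (tail_mem_partitionsInBox hG), rowLen_bot,
      Nat.sub_self, pow_zero, one_mul]
    have hiff : G = ⊥ ↔ 0 = G.rowLen 0 := by rw [eq_bot_iff_rowLen_zero, eq_comm]
    have hiff' : G.tail = ⊥ ↔ G.rowLen 1 = 0 := by rw [eq_bot_iff_rowLen_zero, rowLen_tail]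
    have := G.rowLen_anti 0 1 (Nat.le_succ 0)
    rw [hiff, hiff']
    split_ifs <;> first | rfl | omega

/-- The refinement of the identity by the first rows `G` of the successive inner shapes of the
second tableau, which become the first row of the plane partition. -/
theorem sum_schurPoly_mul_chainPoly (a b c : ℕ) (x z : ℕ → R) {G : YoungDiagram}
    (hG : G ∈ partitionsInBox b c) :
    ∑ ν ∈ partitionsInBox a c, schurPoly ν a x * chainPoly b z ν G =
      dualGrothendieckPoly G a b x z := by
  classical
  induction a generalizing x G with
  | zero =>
    rw [partitionsInBox_zero_left, Finset.sum_singleton, schurPoly_zero, if_pos rfl, one_mul,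
      chainPoly_bot z hG, dualGrothendieckPoly_zero]
  | succ a ih =>
    set x' : ℕ → R := fun i => x (i + 1) with hx'
    have hsub : partitionsInBox a c ⊆ partitionsInBox (a + 1) c := by
      intro μ hμ
      rw [mem_partitionsInBox] at hμ ⊢
      have := μ.rowLen_anti _ _ (Nat.le_succ a)
      simp only [Nat.succ_eq_add_one] at this
      omega
    calc ∑ ν ∈ partitionsInBox (a + 1) c, schurPoly ν (a + 1) x * chainPoly b z ν G
        = ∑ μ ∈ partitionsInBox (a + 1) c, schurPoly μ a x' *
          ∑ ν ∈ partitionsInBox (a + 1) c with μ.Interlaces ν,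
            x 0 ^ (ν.card - μ.card) * chainPoly b z ν G := by
          simp only [Finset.mul_sum, Finset.sum_filter]
          rw [Finset.sum_comm]
          refine Finset.sum_congr rfl fun ν hν => ?_
          rw [schurPoly_succ, interlacing_eq_filter hν, Finset.sum_filter, Finset.sum_mul]
          refine Finset.sum_congr rfl fun μ _ => ?_
          split_ifs <;> ring
      _ = ∑ μ ∈ partitionsInBox a c, schurPoly μ a x' *
          ∑ ν ∈ partitionsInBox (a + 1) c with μ.Interlaces ν,
            x 0 ^ (ν.card - μ.card) * chainPoly b z ν G := by
          symm
          refine Finset.sum_subset hsub fun μ hμ hμ' => ?_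
          rw [mem_partitionsInBox] at hμ hμ'
          rw [schurPoly_eq_zero (by tauto), zero_mul]
      _ = ∑ μ ∈ partitionsInBox a c, schurPoly μ a x' *
          ∑ g ∈ partitionsInBox b c, chainPoly b z μ g * rowWeight b (x 0) z g G :=
          Finset.sum_congr rfl fun μ hμ => by
            rw [sum_interlaces_chainPoly a b c (x 0) z μ G hμ hG]
      _ = ∑ g ∈ partitionsInBox b c, rowWeight b (x 0) z g G *
          ∑ μ ∈ partitionsInBox a c, schurPoly μ a x' * chainPoly b z μ g := by
          simp only [Finset.mul_sum]
          rw [Finset.sum_comm]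
          exact Finset.sum_congr rfl fun g _ => Finset.sum_congr rfl fun μ _ => by ring
      _ = dualGrothendieckPoly G (a + 1) b x z := by
          rw [dualGrothendieckPoly_succ a b c x z hG]
          exact Finset.sum_congr rfl fun g hg => by rw [ih x' hg]

end Recursion

/-! ### The bounded Cauchy identity -/

/-- For all `x` and `z` in any commutative ring `R`; with `R` a polynomial ring and the terms of
`x` and `z` its variables, this is the identity of polynomials. -/
theorem lemma3p3 {R : Type*} [CommRing R] (a b c : ℕ) (x z : ℕ → R) :
    ∑ μ ∈ partitionsInBox (min a b) c, schurPoly μ a x * schurPoly μ b z =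
      ∑ μ ∈ partitionsInBox b c, dualGrothendieckPoly μ a b x z := by
  have hsub : partitionsInBox (min a b) c ⊆ partitionsInBox a c := by
    intro μ hμ
    rw [mem_partitionsInBox] at hμ ⊢
    have := μ.rowLen_anti _ _ (min_le_left a b)
    omega
  calc ∑ μ ∈ partitionsInBox (min a b) c, schurPoly μ a x * schurPoly μ b z
      = ∑ μ ∈ partitionsInBox a c, schurPoly μ a x * schurPoly μ b z := by
        refine Finset.sum_subset hsub fun μ hμ hμ' => ?_
        rw [mem_partitionsInBox] at hμ hμ'
        rw [schurPoly_eq_zero (n := b), mul_zero]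
        intro hb
        rcases min_choice a b with h | h <;> rw [h] at hμ' <;> tauto
    _ = ∑ μ ∈ partitionsInBox a c, ∑ G ∈ partitionsInBox b c,
          schurPoly μ a x * chainPoly b z μ G := by
        refine Finset.sum_congr rfl fun μ hμ => ?_
        rw [← Finset.mul_sum, sum_chainPoly_eq_schurPoly b c z μ (mem_partitionsInBox.1 hμ).2]
    _ = ∑ G ∈ partitionsInBox b c, dualGrothendieckPoly G a b x z := by
        rw [Finset.sum_comm]
        exact Finset.sum_congr rfl fun G hG => sum_schurPoly_mul_chainPoly a b c x z hG
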